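/- A hoop is an algebra $\langle A,\odot,\to,1\rangle$ such that $\langle A,\odot,1\rangle$ is an abelian monoid and $x\to x=1$, $(x\to y)\odot x=(y\to x)\odot y$ and $x\to(y\to z)=(x\odot y)\to z$ hold for all $x,y,z\in A$. A bounded hoop $\langle A,\odot,\to,0,1\rangle$ is a hoop with a constant $0$ such that $0\to x=1$ for all $x$. Homomorphisms of bounded hoops preserve $\odot,\to,0,1$; hoop homomorphisms are only required to preserve $\odot,\to,1$. A bounded hoop $A$ is injective if for every injective homomorphism $f:B\to C$ and every homomorphism $g:B\to A$ of bounded hoops there is a homomorphism $h:C\to A$ of bounded hoops with $hf=g$. A bounded hoop $B$ is a retract of a bounded hoop $A$ if there are homomorphisms $g:B\to A$ and $f:A\to B$ of bounded hoops with $fg=1_B$. An algebra is simple if it is nontrivial and has only the diagonal and the total congruence; it is semisimple if it is a subdirect product of simple algebras. Let $R_{[0,1]}$ be the MV-algebra on the real unit interval $[0,1]$ with $x\odot y=\max(0,x+y-1)$ and $x\to y=\min(1,1-x+y)$ (and the usual $\wedge,\vee,0,1$), regarded as a bounded hoop. **Corollary 14.8 (injective bounded hoops).** 1. A bounded hoop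 is injective in the variety of bounded hoops if and only if it is a retract of a power $R_{[0,1]}^{I}$ for some (possibly empty) set $I$. 2. Every injective bounded hoop is semisimple. 3. Every simple bounded hoop $\langle A,\odot,\to,0,1\rangle$ is a simple MV-algebra: there are lattice operations $\wedge,\vee$ on $A$ such that $\langle A,\wedge,\vee,\odot,\to,0,1\rangle$ is an MV-algebra, that is, a bounded lattice which is a commutative integral residuated lattice satisfying $(x\to y)\vee(y\to x)=1$, $x\odot(x\to y)=x\wedge y$ and $(x\to 0)\to 0=x$, and this MV-algebra is simple. 4. If $A$ and $B$ are simple bounded hoops and $\varphi:A\to B$ is a hoop homomorphism that is not constantly $1$, then $\varphi(0)=0$. -/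

import Mathlib

universe u v w

namespace BH

/-! ### Hoops and bounded hoops

The monoid operation `⊙` is written `*`, the residuum `→` is written `⇨`. -/

/-- A hoop: an algebra `⟨A, ⊙, →, 1⟩` of type `⟨2, 2, 0⟩`. -/
class Hoop (A : Type u) extends CommMonoid A, HImp A where
  imp_self : ∀ x : A, x ⇨ x = 1
  imp_mul_comm : ∀ x y : A, (x ⇨ y) * x = (y ⇨ x) * y
  imp_imp : ∀ x y z : A, x ⇨ (y ⇨ z) = (x * y) ⇨ z

/-- A bounded hoop: an algebra `⟨A, ⊙, →, 0, 1⟩` of type `⟨2, 2, 0, 0⟩`. -/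
class BoundedHoop (A : Type u) extends Hoop A, Zero A where
  zero_imp : ∀ x : A, (0 : A) ⇨ x = 1

/-- Homomorphisms of hoops. -/
structure IsHoopHom {A : Type u} {B : Type v} [Hoop A] [Hoop B] (f : A → B) : Prop where
  map_one : f 1 = 1
  map_mul : ∀ x y, f (x * y) = f x * f y
  map_imp : ∀ x y, f (x ⇨ y) = f x ⇨ f y

/-- Homomorphisms of bounded hoops, the morphisms of the variety of bounded hoops. -/
structure IsHom {A : Type u} {B : Type v} [BoundedHoop A] [BoundedHoop B] (f : A → B) : Prop
    extends IsHoopHom f where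
  map_zero : f 0 = 0

/-- Direct products of bounded hoops, with the pointwise operations. -/
instance piBoundedHoop {I : Type u} (S : I → Type v) [∀ i, BoundedHoop (S i)] :
    BoundedHoop (∀ i, S i) where
  imp_self x := funext fun i => Hoop.imp_self (x i)
  imp_mul_comm x y := funext fun i => Hoop.imp_mul_comm (x i) (y i)
  imp_imp x y z := funext fun i => Hoop.imp_imp (x i) (y i) (z i)
  zero_imp x := funext fun i => BoundedHoop.zero_imp (x i)

/-- `A` is injective in the variety of bounded hoops: homomorphisms into `A` extend along
monomorphisms (injective homomorphisms). -/
def IsInjective (A : Type u) [BoundedHoop A] : Prop :=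
  ∀ (B C : Type u) [BoundedHoop B] [BoundedHoop C] (f : B → C) (g : B → A),
    IsHom f → Function.Injective f → IsHom g → ∃ h : C → A, IsHom h ∧ h ∘ f = g

/-- `B` is a retract of `A` in the variety of bounded hoops. -/
def IsRetract (B : Type u) (A : Type v) [BoundedHoop B] [BoundedHoop A] : Prop :=
  ∃ (g : B → A) (f : A → B), IsHom g ∧ IsHom f ∧ f ∘ g = id

/-- Congruences of a (bounded) hoop. -/
structure IsCongruence {A : Type u} [BoundedHoop A] (r : Setoid A) : Prop where
  mul : ∀ x x' y y', r x x' → r y y' → r (x * y) (x' * y')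
  imp : ∀ x x' y y', r x x' → r y y' → r (x ⇨ y) (x' ⇨ y')

/-- A simple bounded hoop: it is nontrivial, and its only congruences are the diagonal `⊥` and
the total relation `⊤`. -/
def IsSimple (A : Type u) [BoundedHoop A] : Prop :=
  Nontrivial A ∧ ∀ r : Setoid A, IsCongruence r → r = ⊥ ∨ r = ⊤

/-- A semisimple bounded hoop: a subdirect product of simple bounded hoops. -/
def IsSemisimple (A : Type u) [BoundedHoop A] : Prop :=
  ∃ (I : Type u) (S : I → Type u) (_ : ∀ i, BoundedHoop (S i)) (e : A → ∀ i, S i),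
    (∀ i, IsSimple (S i)) ∧ IsHom e ∧ Function.Injective e ∧
      ∀ i, Function.Surjective fun a => e a i

/-! ### MV-algebras -/

/-- `⟨A, ∧, ∨, ⊙, →, 0, 1⟩` is a residuated lattice (that `⟨A, ⊙, 1⟩` is an abelian monoid and
`⟨A, ∧, ∨⟩` a lattice is contained in the instance arguments). -/
structure IsResiduatedLattice (A : Type u) [CommMonoid A] [HImp A] [Zero A] [Lattice A] :
    Prop where
  zero_le : ∀ x : A, 0 ≤ x
  le_one : ∀ x : A, x ≤ 1
  mul_imp : ∀ x y z : A, (x * y) ⇨ z = x ⇨ (y ⇨ z)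
  imp_mul_inf : ∀ x y : A, ((x ⇨ y) * x) ⊓ y = (x ⇨ y) * x
  inf_imp : ∀ x y : A, (x ⊓ y) ⇨ y = 1

/-- An MV-algebra: a residuated lattice that is prelinear, divisible and involutive. -/
structure IsMVAlgebra (A : Type u) [CommMonoid A] [HImp A] [Zero A] [Lattice A] : Prop
    extends IsResiduatedLattice A where
  prelinear : ∀ x y : A, (x ⇨ y) ⊔ (y ⇨ x) = 1
  divisible : ∀ x y : A, x * (x ⇨ y) = x ⊓ y
  involutive : ∀ x : A, (x ⇨ 0) ⇨ 0 = x

/-- Simplicity in the full signature of MV-algebras. -/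
def IsSimpleMV (A : Type u) [CommMonoid A] [HImp A] [Zero A] [Lattice A] : Prop :=
  Nontrivial A ∧ ∀ r : Setoid A,
    (∀ x x' y y', r x x' → r y y' →
      r (x * y) (x' * y') ∧ r (x ⇨ y) (x' ⇨ y') ∧ r (x ⊓ y) (x' ⊓ y') ∧ r (x ⊔ y) (x' ⊔ y')) →
    r = ⊥ ∨ r = ⊤

/-- The carrier of the MV-algebra `R_[0,1]`: the real unit interval. (A separate type, so that
the product of real numbers is not taken for the monoid operation.) -/
def R01 : Type := Set.Icc (0 : ℝ) 1

namespace R01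

/-- `x ⊙ y = max(0, x + y - 1)`. -/
noncomputable def mul (x y : R01) : R01 :=
  ⟨max 0 (x.1 + y.1 - 1), le_max_left _ _,
    max_le zero_le_one (by have hx := x.2.2; have hy := y.2.2; linarith)⟩

/-- `x → y = min(1, 1 - x + y)`. -/
noncomputable def imp (x y : R01) : R01 :=
  ⟨min 1 (1 - x.1 + y.1), le_min zero_le_one (by have hx := x.2.2; have hy := y.2.1; linarith),
    min_le_left _ _⟩

/-- The real number `0`. -/
def zero : R01 := ⟨0, le_refl _, zero_le_one⟩

/-- The real number `1`. -/
def one : R01 := ⟨1, zero_le_one, le_refl _⟩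

end R01

/-- `R_[0,1]` as a bounded hoop. -/
noncomputable instance : BoundedHoop R01 where
  mul := R01.mul
  one := R01.one
  himp := R01.imp
  zero := R01.zero
  mul_assoc := by
    rintro ⟨x, hx0, hx1⟩ ⟨y, hy0, hy1⟩ ⟨z, hz0, hz1⟩
    refine Subtype.ext ?_
    change max 0 (max 0 (x + y - 1) + z - 1) = max 0 (x + max 0 (y + z - 1) - 1)
    grind
  one_mul := by
    rintro ⟨x, hx0, hx1⟩
    refine Subtype.ext ?_
    change max 0 (1 + x - 1) = x
    grind
  mul_one := by
    rintro ⟨x, hx0, hx1⟩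
    refine Subtype.ext ?_
    change max 0 (x + 1 - 1) = x
    grind
  mul_comm := by
    rintro ⟨x, hx0, hx1⟩ ⟨y, hy0, hy1⟩
    refine Subtype.ext ?_
    change max 0 (x + y - 1) = max 0 (y + x - 1)
    grind
  imp_self := by
    rintro ⟨x, hx0, hx1⟩
    refine Subtype.ext ?_
    change min 1 (1 - x + x) = 1
    grind
  imp_mul_comm := by
    rintro ⟨x, hx0, hx1⟩ ⟨y, hy0, hy1⟩
    refine Subtype.ext ?_
    change max 0 (min 1 (1 - x + y) + x - 1) = max 0 (min 1 (1 - y + x) + y - 1)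
    grind
  imp_imp := by
    rintro ⟨x, hx0, hx1⟩ ⟨y, hy0, hy1⟩ ⟨z, hz0, hz1⟩
    refine Subtype.ext ?_
    change min 1 (1 - x + min 1 (1 - y + z)) = min 1 (1 - max 0 (x + y - 1) + z)
    grind
  zero_imp := by
    rintro ⟨x, hx0, hx1⟩
    refine Subtype.ext ?_
    change min 1 (1 - 0 + x) = 1
    grind

end BH

/-! Simplicity of a bounded hoop means that every element other than `1` is nilpotent
(`nil_iff_isSimple`). Such a hoop is involutive and totally ordered, and counting how many factors
`e` are needed to get below `a` measures the distance from `a` to `1`. Normalized limits of these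
counts give a homomorphism to `R01` (`Nil.exists_hom`), so by Zorn's lemma every proper filter is
killed by some homomorphism to `R01`.

Powers of `R01` are injective because a homomorphism to `R01` is determined by any lower bound of
its kernel (`R01.hom_ext_of_le`): a homomorphism on `C` that kills the image of the kernel of `g`
already extends `g`.

Conversely, let `A` be injective. Extending along two suitable embeddings creates a least dense
element and a least element of the radical; each must be `1`. The first makes `A` involutive, the
second makes the homomorphisms to `R01` separate points. So `A` embeds in a power of `R01`, is a
retract of it by injectivity, and is semisimple. -/

namespace BH

/-! ### Order and arithmetic of hoops -/

namespace Hoop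

/-- The natural order of a hoop. -/
abbrev Le {A : Type u} [Hoop A] (x y : A) : Prop := x ⇨ y = 1

end Hoop

scoped infix:50 " ≼ " => Hoop.Le

namespace Hoop

variable {A : Type u} [Hoop A]

/-- Commuting gives `1 ⇨ x = (x ⇨ 1) * x`, and `h7` shows that `x` absorbs `x ⇨ 1`. -/
theorem one_imp (x : A) : 1 ⇨ x = x := by
  have h1 : ∀ y : A, 1 ⇨ y = (y ⇨ 1) * y := fun y => by
    have := imp_mul_comm 1 y
    rwa [mul_one] at this
  have h2 : ∀ y z : A, y ⇨ (1 ⇨ z) = y ⇨ z := fun y z => by rw [imp_imp, mul_one]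
  have h3 : ∀ y z : A, 1 ⇨ (y ⇨ z) = y ⇨ z := fun y z => by rw [imp_imp, one_mul]
  have h4 : x = ((1 ⇨ x) ⇨ x) * (1 ⇨ x) := by
    have := imp_mul_comm x (1 ⇨ x)
    rwa [h2, imp_self, one_mul] at this
  have h5 : (1 ⇨ x) ⇨ x = (x ⇨ 1) ⇨ 1 := by
    rw [h1 x, ← imp_imp, imp_self]
  have h6 : ((x ⇨ 1) ⇨ 1) * (x ⇨ 1) = x ⇨ 1 := by
    rw [← h1, h3]
  have h7 : x = (x ⇨ 1) * x := by
    conv_lhs => rw [h4, h5, h1 x, ← mul_assoc, h6]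
  rw [h1, ← h7]

theorem le_one (x : A) : x ≼ 1 := by
  have h7 : (x ⇨ 1) * x = x := by
    have := imp_mul_comm x 1
    rwa [mul_one, one_imp] at this
  change x ⇨ 1 = 1
  conv_lhs => rw [← h7]
  rw [← imp_imp, imp_self]

theorem le_refl (x : A) : x ≼ x := imp_self x

theorem le_antisymm {x y : A} (h : x ≼ y) (h' : y ≼ x) : x = y := by
  have := imp_mul_comm x y
  rwa [h, h', one_mul, one_mul] at this

theorem le_trans {x y z : A} (h : x ≼ y) (h' : y ≼ z) : x ≼ z := by
  have e : x = (y ⇨ x) * y := by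
    have := imp_mul_comm x y
    rwa [h, one_mul] at this
  change x ⇨ z = 1
  rw [e, ← imp_imp, h', le_one]

theorem eq_one_of_one_le {x : A} (h : (1 : A) ≼ x) : x = 1 := by
  rwa [Le, one_imp] at h

theorem le_imp_iff {x y z : A} : x ≼ y ⇨ z ↔ x * y ≼ z := by
  simp only [Le, imp_imp]

theorem mul_le_right (x y : A) : x * y ≼ y := by
  rw [← le_imp_iff, imp_self]; exact le_one x

theorem mul_le_left (x y : A) : x * y ≼ x := by
  rw [mul_comm]; exact mul_le_right y x

theorem le_imp (x y : A) : x ≼ y ⇨ x := le_imp_iff.2 (mul_le_left x y)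

theorem imp_mul_le (x y : A) : (x ⇨ y) * x ≼ y := le_imp_iff.1 (le_refl _)

theorem mul_le_mul_right {x y : A} (h : x ≼ y) (z : A) : x * z ≼ y * z :=
  le_imp_iff.1 (le_trans h (le_imp_iff.2 (le_refl _)))

theorem mul_le_mul {x y z t : A} (h : x ≼ y) (h' : z ≼ t) : x * z ≼ y * t := by
  refine le_trans (mul_le_mul_right h z) ?_
  rw [mul_comm y z, mul_comm y t]
  exact mul_le_mul_right h' y

theorem imp_le_imp {x y z t : A} (h : x ≼ y) (h' : z ≼ t) : y ⇨ z ≼ x ⇨ t :=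
  le_imp_iff.2 (le_trans (mul_le_mul (le_refl _) h) (le_trans (imp_mul_le y z) h'))

theorem imp_mul_of_le {x y : A} (h : y ≼ x) : (x ⇨ y) * x = y := by
  rw [imp_mul_comm, h, one_mul]

theorem le_imp_imp (x y : A) : x ≼ (x ⇨ y) ⇨ y :=
  le_imp_iff.2 (by rw [mul_comm]; exact imp_mul_le x y)

theorem imp_comm (x y z : A) : x ⇨ (y ⇨ z) = y ⇨ (x ⇨ z) := by
  rw [imp_imp, imp_imp, mul_comm]

theorem imp_imp_imp (x y : A) : ((x ⇨ y) ⇨ y) ⇨ y = x ⇨ y :=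
  le_antisymm (imp_le_imp (le_imp_imp x y) (le_refl y)) (le_imp_imp (x ⇨ y) y)

theorem pow_le_pow_right {m n : ℕ} (x : A) (h : m ≤ n) : x ^ n ≼ x ^ m := by
  obtain ⟨k, rfl⟩ := Nat.exists_eq_add_of_le h
  rw [pow_add]; exact mul_le_left _ _

theorem pow_le_pow_left {x y : A} (h : x ≼ y) (n : ℕ) : x ^ n ≼ y ^ n := by
  induction n with
  | zero => rw [pow_zero, pow_zero]; exact le_refl _
  | succ n ih => rw [pow_succ, pow_succ]; exact mul_le_mul ih h

theorem pow_imp_eq {x y : A} (h : x ⇨ y = y) (n : ℕ) : x ^ n ⇨ y = y := by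
  induction n with
  | zero => rw [pow_zero, one_imp]
  | succ n ih => rw [pow_succ, ← imp_imp, h, ih]

theorem imp_trans_le (x y z : A) : (x ⇨ y) * (y ⇨ z) ≼ x ⇨ z := by
  rw [le_imp_iff, mul_right_comm]
  refine le_trans (mul_le_mul_right (imp_mul_le x y) _) ?_
  rw [mul_comm]; exact imp_mul_le y z

theorem imp_imp_mul (x y : A) : x ⇨ ((x ⇨ y) * x) = x ⇨ y :=
  le_antisymm (imp_le_imp (le_refl x) (imp_mul_le x y)) (le_imp_iff.2 (le_refl _))

end Hoop

/-! ### Bounded hoops -/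

namespace Hoop

variable {A : Type u} [BoundedHoop A]

theorem zero_le (x : A) : 0 ≼ x := BoundedHoop.zero_imp x

theorem eq_zero_of_le {x : A} (h : x ≼ 0) : x = 0 := le_antisymm h (zero_le x)

theorem zero_mul (x : A) : 0 * x = 0 := eq_zero_of_le (mul_le_left 0 x)

theorem mul_zero (x : A) : x * 0 = 0 := eq_zero_of_le (mul_le_right x 0)

theorem imp_zero_mul (x : A) : (x ⇨ 0) * x = 0 := eq_zero_of_le (imp_mul_le x 0)

/-- The double negation law holds up to a dense element. -/
theorem dense_double_neg (x : A) : (((x ⇨ 0) ⇨ 0) ⇨ x) ⇨ 0 = 0 := by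
  set d := ((x ⇨ 0) ⇨ 0) ⇨ x
  have hx : d * ((x ⇨ 0) ⇨ 0) = x := imp_mul_of_le (le_imp_imp x 0)
  have h1 : d ⇨ (x ⇨ 0) = x ⇨ 0 := by
    conv_rhs => rw [← hx, ← imp_imp, imp_imp_imp]
  have h2 : x ⇨ 0 ≼ d := by
    have : ((x ⇨ 0) ⇨ 0) ⇨ 0 ≼ d := imp_le_imp (le_refl _) (zero_le x)
    rwa [imp_imp_imp] at this
  have h3 : (x ⇨ 0) * d = x ⇨ 0 := by
    have := imp_mul_comm d (x ⇨ 0)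
    rwa [h1, h2, one_mul] at this
  -- So `d ⇨ 0` is a multiple of `x ⇨ 0`, which absorbs `d` by `h3`. Hence `d ⇨ 0` absorbs `d` too,
  -- but its product with `d` is `0`.
  have h4 : ((x ⇨ 0) ⇨ (d ⇨ 0)) * (x ⇨ 0) = d ⇨ 0 :=
    imp_mul_of_le (imp_le_imp (le_imp x _) (le_refl 0))
  calc d ⇨ 0 = ((x ⇨ 0) ⇨ (d ⇨ 0)) * ((x ⇨ 0) * d) := by rw [h3, h4]
    _ = (d ⇨ 0) * d := by rw [← mul_assoc, h4]
    _ = 0 := imp_zero_mul d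

/-- Dense elements are closed under products. -/
theorem dense_mul {x y : A} (hx : x ⇨ 0 = 0) (hy : y ⇨ 0 = 0) : (x * y) ⇨ 0 = 0 := by
  rw [← imp_imp, hy, hx]

/-- Dense elements are upward closed. -/
theorem dense_of_le {x y : A} (hx : x ⇨ 0 = 0) (h : x ≼ y) : y ⇨ 0 = 0 := by
  have : y ⇨ 0 ≼ x ⇨ 0 := imp_le_imp h (le_refl _)
  rw [hx] at this
  exact eq_zero_of_le this

/-- `A` satisfies the double negation law. -/
def Involutive (A : Type u) [BoundedHoop A] : Prop := ∀ x : A, (x ⇨ 0) ⇨ 0 = x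

theorem involutive_of_dense (h : ∀ x : A, x ⇨ 0 = 0 → x = 1) : Involutive A := fun x =>
  le_antisymm (h _ (dense_double_neg x)) (le_imp_imp x 0)

namespace Involutive

variable (hA : Involutive A)
include hA

theorem contrapose (x y : A) : x ⇨ y = (y ⇨ 0) ⇨ (x ⇨ 0) := by
  rw [imp_comm, hA]

/-- Each side is the negation of the meet of `x ⇨ 0` and `y ⇨ 0`, which is symmetric by
`imp_mul_comm`. -/
theorem imp_imp_comm (x y : A) : (x ⇨ y) ⇨ y = (y ⇨ x) ⇨ x := by
  have h : ∀ x y : A, (x ⇨ y) ⇨ y = (((y ⇨ 0) ⇨ (x ⇨ 0)) * (y ⇨ 0)) ⇨ 0 := fun x y => by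
    rw [← imp_imp, hA, ← hA.contrapose]
  rw [h, h y x, imp_mul_comm]

theorem imp_imp_le {x y z : A} (h : x ≼ z) (h' : y ≼ z) : (x ⇨ y) ⇨ y ≼ z := by
  have : (x ⇨ y) ⇨ y ≼ (z ⇨ y) ⇨ y := imp_le_imp (imp_le_imp h (le_refl _)) (le_refl _)
  rwa [hA.imp_imp_comm z y, h', one_imp] at this

/-- Prelinearity in implicational form. With `m` the meet of `x` and `y`, the left side is `(x ⇨ m)
⇨ (y ⇨ m) = y ⇨ ((x ⇨ m) ⇨ m)`, and the inner join of `x` and `m` is `x`. -/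
theorem imp_imp_imp_swap (x y : A) : (x ⇨ y) ⇨ (y ⇨ x) = y ⇨ x := by
  have hm : (x ⇨ y) * x ≼ x := mul_le_right _ _
  have hyx : y ⇨ ((x ⇨ y) * x) = y ⇨ x := by rw [imp_mul_comm, imp_imp_mul]
  conv_lhs => rw [← imp_imp_mul x y, ← hyx, imp_comm, hA.imp_imp_comm x, hm, one_imp]

end Involutive

/-! ### Simplicity and nilpotency -/

/-- Every element other than `1` is nilpotent. This characterizes simplicity. -/
def Nil (A : Type u) [BoundedHoop A] : Prop :=
  (0 : A) ≠ 1 ∧ ∀ x : A, x ≠ 1 → ∃ n : ℕ, x ^ n = 0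

namespace Nil

variable (hA : Nil A)
include hA

theorem involutive : Involutive A := involutive_of_dense fun x hx => by
  by_contra hne
  obtain ⟨n, hn⟩ := hA.2 x hne
  have h : ∀ n : ℕ, x ^ n ⇨ 0 = 0 := pow_imp_eq hx
  have := h n
  rw [hn, imp_self] at this
  exact hA.1 this.symm

/-- The hypothesis iterates to `x ^ n ⇨ y = y`; once `x ^ n = 0`, this reads `1 = y`. -/
theorem eq_one_or_eq_one {x y : A} (h : x ⇨ y = y) : x = 1 ∨ y = 1 := by
  by_contra hne
  push Not at hne
  obtain ⟨n, hn⟩ := hA.2 x hne.1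
  have := pow_imp_eq h n
  rw [hn, zero_le] at this
  exact hne.2 this.symm

theorem total (x y : A) : x ≼ y ∨ y ≼ x :=
  hA.eq_one_or_eq_one (hA.involutive.imp_imp_imp_swap x y)

/-- If `y` is strictly below `z`, then `x * y` absorbs `z ⇨ y`, hence all its powers, one of which
is `0`. -/
theorem mul_cancel {x y z : A} (h : x * y = x * z) (h0 : x * y ≠ 0) : y = z := by
  have key : ∀ {y z : A}, x * y = x * z → x * y ≠ 0 → y ≼ z → y = z := by
    intro y z h h0 hle
    refine le_antisymm hle ?_
    by_contra hne
    obtain ⟨n, hn⟩ := hA.2 _ hne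
    have hd : ∀ n : ℕ, x * y * (z ⇨ y) ^ n = x * y := fun n => by
      induction n with
      | zero => rw [pow_zero, mul_one]
      | succ n ih =>
        rw [pow_succ, ← mul_assoc, ih]
        conv_lhs => rw [h, mul_assoc, mul_comm z, imp_mul_of_le hle]
    have := hd n
    rw [hn, mul_zero] at this
    exact h0 this.symm
  rcases hA.total y z with hle | hle
  · exact key h h0 hle
  · exact (key h.symm (h ▸ h0) hle).symm

end Nil

end Hoop
end BH

namespace BH

/-! ### Homomorphisms -/

namespace IsHom

open Hoop

variable {A : Type u} {B : Type v} {C : Type w} [BoundedHoop A] [BoundedHoop B] [BoundedHoop C]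

theorem comp {g : B → C} {f : A → B} (hg : IsHom g) (hf : IsHom f) : IsHom (g ∘ f) where
  map_one := by simp only [Function.comp, hf.map_one, hg.map_one]
  map_mul x y := by simp only [Function.comp, hf.map_mul, hg.map_mul]
  map_imp x y := by simp only [Function.comp, hf.map_imp, hg.map_imp]
  map_zero := by simp only [Function.comp, hf.map_zero, hg.map_zero]

theorem map_pow {f : A → B} (hf : IsHom f) (x : A) (n : ℕ) : f (x ^ n) = f x ^ n := by
  induction n with
  | zero => rw [pow_zero, pow_zero, hf.map_one]
  | succ n ih => rw [pow_succ, pow_succ, hf.map_mul, ih]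

theorem map_neg {f : A → B} (hf : IsHom f) (x : A) : f (x ⇨ 0) = f x ⇨ 0 := by
  rw [hf.map_imp, hf.map_zero]

theorem map_le {f : A → B} (hf : IsHom f) {x y : A} (h : x ≼ y) : f x ≼ f y := by
  rw [Le, ← hf.map_imp, h, hf.map_one]

theorem injective_of_kernel {f : A → B} (hf : IsHom f) (h : ∀ x, f x = 1 → x = 1) :
    Function.Injective f := fun x y hxy =>
  Hoop.le_antisymm (h _ (by rw [hf.map_imp, hxy, Hoop.imp_self]))
    (h _ (by rw [hf.map_imp, hxy, Hoop.imp_self]))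

end IsHom

/-! ### Filters and quotients -/

/-- A filter of a hoop. -/
structure IsFilter {A : Type u} [Hoop A] (F : Set A) : Prop where
  one_mem : 1 ∈ F
  mul_mem : ∀ {x y}, x ∈ F → y ∈ F → x * y ∈ F
  mem_of_le : ∀ {x y}, x ∈ F → x ≼ y → y ∈ F

namespace IsFilter

open Hoop

variable {A : Type u} [BoundedHoop A] {F : Set A} (hF : IsFilter F)
include hF

theorem pow_mem {x : A} (hx : x ∈ F) (n : ℕ) : x ^ n ∈ F := by
  induction n with
  | zero => rw [pow_zero]; exact hF.one_mem
  | succ n ih => rw [pow_succ]; exact hF.mul_mem ih hx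

theorem imp_trans {x y z : A} (h : x ⇨ y ∈ F) (h' : y ⇨ z ∈ F) : x ⇨ z ∈ F :=
  hF.mem_of_le (hF.mul_mem h h') (imp_trans_le x y z)

theorem imp_mul_mul {x y z t : A} (h : x ⇨ y ∈ F) (h' : z ⇨ t ∈ F) :
    (x * z) ⇨ (y * t) ∈ F := by
  refine hF.mem_of_le (hF.mul_mem h h') ?_
  rw [le_imp_iff, mul_mul_mul_comm]
  exact mul_le_mul (imp_mul_le x y) (imp_mul_le z t)

theorem imp_imp_imp {x y z t : A} (h : y ⇨ x ∈ F) (h' : z ⇨ t ∈ F) :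
    (x ⇨ z) ⇨ (y ⇨ t) ∈ F := by
  refine hF.mem_of_le (hF.mul_mem h h') ?_
  rw [le_imp_iff, mul_right_comm]
  exact le_trans (mul_le_mul_right (imp_trans_le y x z) _) (imp_trans_le y z t)

/-- The congruence of a filter. -/
def setoid : Setoid A where
  r x y := x ⇨ y ∈ F ∧ y ⇨ x ∈ F
  iseqv :=
    { refl := fun x => by rw [Hoop.imp_self]; exact ⟨hF.one_mem, hF.one_mem⟩
      symm := fun h => ⟨h.2, h.1⟩
      trans := fun h h' => ⟨hF.imp_trans h.1 h'.1, hF.imp_trans h'.2 h.2⟩ }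

theorem isCongruence : IsCongruence hF.setoid where
  mul _ _ _ _ h h' := ⟨hF.imp_mul_mul h.1 h'.1, hF.imp_mul_mul h.2 h'.2⟩
  imp _ _ _ _ h h' := ⟨hF.imp_imp_imp h.2 h'.1, hF.imp_imp_imp h.1 h'.2⟩

/-- The quotient by a filter. -/
def Quo : Type u := Quotient hF.setoid

instance : BoundedHoop hF.Quo where
  mul := Quotient.map₂ (· * ·) fun _ _ h _ _ h' => hF.isCongruence.mul _ _ _ _ h h'
  one := Quotient.mk _ 1
  himp := Quotient.map₂ (· ⇨ ·) fun _ _ h _ _ h' => hF.isCongruence.imp _ _ _ _ h h'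
  zero := Quotient.mk _ 0
  mul_assoc := by
    rintro ⟨x⟩ ⟨y⟩ ⟨z⟩
    exact congrArg (Quotient.mk _) (mul_assoc x y z)
  one_mul := by
    rintro ⟨x⟩
    exact congrArg (Quotient.mk _) (one_mul x)
  mul_one := by
    rintro ⟨x⟩
    exact congrArg (Quotient.mk _) (mul_one x)
  mul_comm := by
    rintro ⟨x⟩ ⟨y⟩
    exact congrArg (Quotient.mk _) (mul_comm x y)
  imp_self := by
    rintro ⟨x⟩
    exact congrArg (Quotient.mk _) (Hoop.imp_self x)
  imp_mul_comm := by
    rintro ⟨x⟩ ⟨y⟩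
    exact congrArg (Quotient.mk _) (imp_mul_comm x y)
  imp_imp := by
    rintro ⟨x⟩ ⟨y⟩ ⟨z⟩
    exact congrArg (Quotient.mk _) (imp_imp x y z)
  zero_imp := by
    rintro ⟨x⟩
    exact congrArg (Quotient.mk _) (BoundedHoop.zero_imp x)

/-- The quotient map. -/
def proj (x : A) : hF.Quo := Quotient.mk _ x

theorem proj_surjective : Function.Surjective hF.proj := Quotient.mk_surjective

theorem isHom_proj : IsHom hF.proj where
  map_one := rfl
  map_mul _ _ := rfl
  map_imp _ _ := rfl
  map_zero := rfl

theorem proj_eq_one {x : A} : hF.proj x = 1 ↔ x ∈ F := by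
  have : hF.proj x = 1 ↔ x ⇨ 1 ∈ F ∧ 1 ⇨ x ∈ F := Quotient.eq (r := hF.setoid)
  rw [this, one_imp, le_one]
  exact ⟨And.right, fun h => ⟨hF.one_mem, h⟩⟩

/-- The quotient by a filter is nilpotent if the filter is proper and contains the negation of a
power of every element outside it. -/
theorem nil_quo (h0 : (0 : A) ∉ F) (h : ∀ x ∉ F, ∃ n : ℕ, x ^ n ⇨ 0 ∈ F) : Nil hF.Quo := by
  refine ⟨fun h => h0 (hF.proj_eq_one.1 h), fun x hx => ?_⟩
  obtain ⟨x, rfl⟩ := hF.proj_surjective x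
  obtain ⟨n, hn⟩ := h x fun h => hx (hF.proj_eq_one.2 h)
  refine ⟨n, eq_zero_of_le ?_⟩
  rw [← hF.isHom_proj.map_pow, Le, ← hF.isHom_proj.map_neg]
  exact hF.proj_eq_one.2 hn

end IsFilter

namespace Hoop

variable {A : Type u} [BoundedHoop A]

/-- The filter generated by a filter and an element. -/
theorem isFilter_adjoin {F : Set A} (hF : IsFilter F) (x : A) :
    IsFilter {y | ∃ n : ℕ, x ^ n ⇨ y ∈ F} where
  one_mem := ⟨0, by rw [le_one]; exact hF.one_mem⟩
  mul_mem := by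
    rintro y z ⟨m, hm⟩ ⟨n, hn⟩
    exact ⟨m + n, by rw [pow_add]; exact hF.imp_mul_mul hm hn⟩
  mem_of_le := by
    rintro y z ⟨n, hn⟩ h
    exact ⟨n, hF.mem_of_le hn (imp_le_imp (le_refl _) h)⟩

theorem isFilter_singleton_one : IsFilter ({1} : Set A) where
  one_mem := rfl
  mul_mem := by rintro _ _ rfl rfl; exact mul_one 1
  mem_of_le := by rintro _ y rfl h; exact eq_one_of_one_le h

/-- A congruence other than the diagonal identifies some `x ≠ 1` with `1`, hence also `x ^ n = 0`,
and collapses everything. Conversely, the filter generated by `x ≠ 1` must contain `0`. -/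
theorem nil_iff_isSimple : Nil A ↔ IsSimple A := by
  constructor
  · refine fun h => ⟨⟨0, 1, h.1⟩, fun r hr => ?_⟩
    by_cases hx : ∃ x, x ≠ 1 ∧ r x 1
    · right
      obtain ⟨x, hx, hx1⟩ := hx
      obtain ⟨n, hn⟩ := h.2 x hx
      have hp : ∀ n : ℕ, r (x ^ n) 1 := fun n => by
        induction n with
        | zero => rw [pow_zero]
        | succ n ih =>
          have := hr.mul _ _ _ _ ih hx1
          rwa [← pow_succ, mul_one] at this
      have h0 : r 0 1 := hn ▸ hp n
      have h1 : ∀ y, r 1 y := fun y => by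
        have := hr.imp _ _ _ _ h0 (r.refl y)
        rwa [one_imp, zero_le] at this
      exact Setoid.ext fun y z => ⟨fun _ => trivial, fun _ => r.trans (r.symm (h1 y)) (h1 z)⟩
    · left
      push Not at hx
      have key : ∀ y z, r y z → y ≼ z := fun y z hyz => by
        by_contra hne
        refine hx _ hne ?_
        have := hr.imp _ _ _ _ hyz (r.refl z)
        rwa [Hoop.imp_self] at this
      exact Setoid.ext fun y z =>
        ⟨fun hyz => le_antisymm (key y z hyz) (key z y (r.symm hyz)), fun hyz => by
          have hyz : y = z := hyz
          rw [hyz]⟩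
  · rintro ⟨⟨a, b, hab⟩, h⟩
    have h01 : (0 : A) ≠ 1 := fun h01 => hab <| by
      have : ∀ x : A, x = 1 := fun x => eq_one_of_one_le (h01 ▸ zero_le x)
      rw [this a, this b]
    refine ⟨h01, fun x hx => ?_⟩
    have hF := isFilter_adjoin (isFilter_singleton_one (A := A)) x
    rcases h _ hF.isCongruence with h | h
    · have : hF.setoid x 1 := 
        ⟨⟨0, by rw [le_one, le_one]; rfl⟩, ⟨1, by rw [pow_one, one_imp]; exact le_refl x⟩⟩
      rw [h] at this
      exact absurd this hx
    · have : hF.setoid 1 0 := by rw [h]; trivial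
      obtain ⟨n, hn⟩ := this.1
      rw [one_imp] at hn
      exact ⟨n, eq_zero_of_le hn⟩

/-- A proper filter is contained in a proper filter with nilpotent quotient. -/
theorem exists_filter_nil {F : Set A} (hF : IsFilter F) (h0 : (0 : A) ∉ F) :
    ∃ (M : Set A) (hM : IsFilter M), F ⊆ M ∧ Nil hM.Quo := by
  obtain ⟨M, hFM, hM⟩ := zorn_subset_nonempty {G : Set A | IsFilter G ∧ (0 : A) ∉ G} (by
    intro c hc hchain hne
    refine ⟨⋃₀ c, ⟨⟨?_, ?_, ?_⟩, ?_⟩, fun s hs => Set.subset_sUnion_of_mem hs⟩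
    · obtain ⟨G, hG⟩ := hne
      exact ⟨G, hG, (hc hG).1.one_mem⟩
    · rintro x y ⟨G, hG, hx⟩ ⟨G', hG', hy⟩
      rcases hchain.total hG hG' with hle | hle
      · exact ⟨G', hG', (hc hG').1.mul_mem (hle hx) hy⟩
      · exact ⟨G, hG, (hc hG).1.mul_mem hx (hle hy)⟩
    · rintro x y ⟨G, hG, hx⟩ hxy
      exact ⟨G, hG, (hc hG).1.mem_of_le hx hxy⟩
    · rintro ⟨G, hG, h⟩
      exact (hc hG).2 h) F ⟨hF, h0⟩
  refine ⟨M, hM.prop.1, hFM, hM.prop.1.nil_quo hM.prop.2 fun x hx => ?_⟩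
  -- If no power of `x` has its negation in `M`, adjoining `x` keeps `M` proper, so maximality puts
  -- `x` in `M`.
  by_contra hne
  have hle : M ⊆ {y | ∃ n : ℕ, x ^ n ⇨ y ∈ M} := fun y hy =>
    ⟨0, by rwa [pow_zero, one_imp]⟩
  refine hx (hM.le_of_ge ⟨isFilter_adjoin hM.prop.1 x, hne⟩ hle ⟨1, ?_⟩)
  rw [pow_one, Hoop.imp_self]
  exact hM.prop.1.one_mem

end Hoop

/-! ### The unit interval -/

namespace R01

open Hoop

theorem val_mul (x y : R01) : (x * y).1 = max 0 (x.1 + y.1 - 1) := rfl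
theorem val_imp (x y : R01) : (x ⇨ y).1 = min 1 (1 - x.1 + y.1) := rfl
theorem val_zero : (0 : R01).1 = 0 := rfl
theorem val_one : (1 : R01).1 = 1 := rfl
theorem val_nonneg (x : R01) : 0 ≤ x.1 := x.2.1
theorem val_le_one (x : R01) : x.1 ≤ 1 := x.2.2

theorem ext {x y : R01} (h : x.1 = y.1) : x = y := Subtype.ext h

theorem val_pow (x : R01) (n : ℕ) : (x ^ n).1 = max 0 (1 - n * (1 - x.1)) := by
  have := x.val_nonneg
  have := x.val_le_one
  induction n with
  | zero => rw [pow_zero, val_one]; simp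
  | succ n ih => rw [pow_succ, val_mul, ih]; push_cast; grind

theorem nil : Nil R01 := by
  refine ⟨fun h => zero_ne_one (congrArg Subtype.val h), fun x hx => ?_⟩
  have hlt : 0 < 1 - x.1 := sub_pos.2 (lt_of_le_of_ne x.val_le_one fun h => hx (ext h))
  obtain ⟨n, hn⟩ := exists_nat_ge (1 / (1 - x.1))
  refine ⟨n, ext ?_⟩
  rw [val_pow, val_zero]
  rw [div_le_iff₀ hlt] at hn
  exact max_eq_left (by linarith)

variable {B : Type u} [BoundedHoop B]

/-- A homomorphism to the unit interval is determined by its kernel. -/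
theorem hom_ext {f g : B → R01} (hf : IsHom f) (hg : IsHom g) (h : ∀ x, f x = 1 ↔ g x = 1) :
    f = g := by
  have h0 : ∀ x, (f x).1 = 0 ↔ (g x).1 = 0 := fun x => by
    have h1 : ∀ {f : B → R01}, IsHom f → (f (x ⇨ 0) = 1 ↔ (f x).1 = 0) := fun {f} hf => by
      have := (f x).val_nonneg
      rw [hf.map_neg]
      refine ⟨fun h => ?_, fun h => ext ?_⟩
      · have := congrArg Subtype.val h
        rw [val_imp, val_zero, val_one] at this
        grind
      · rw [val_imp, h, val_zero, val_one]; norm_num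
    rw [← h1 hf, ← h1 hg, h]
  -- By `h0` at `x * x`, the values `f x` and `g x` lie on the same side of `1 / 2`. So squaring or
  -- truncated doubling of `x` doubles their difference exactly, and any uniform bound can be
  -- halved.
  have key : ∀ (n : ℕ) (x : B), |(f x).1 - (g x).1| ≤ (1 / 2) ^ n := fun n => by
    induction n with
    | zero =>
      intro x
      have := (f x).2.1
      have := (f x).2.2
      have := (g x).2.1
      have := (g x).2.2
      rw [pow_zero, abs_le]
      constructor <;> linarith
    | succ n ih =>
      intro x
      have i1 := ih (x * x)
      have i2 := ih (((x ⇨ 0) * (x ⇨ 0)) ⇨ 0)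
      have i3 := h0 (x * x)
      simp only [hf.map_mul, hg.map_mul, hf.map_imp, hg.map_imp, hf.map_zero, hg.map_zero] at i1 i2 i3
      have double : ∀ y : R01, y.1 ≤ 1 / 2 → (((y ⇨ 0) * (y ⇨ 0)) ⇨ 0).1 = 2 * y.1 := fun y hy => by
        have := y.val_nonneg
        simp only [val_imp, val_mul, val_zero]
        grind
      have hsq : ∀ y : R01, (y * y).1 = 0 ↔ y.1 ≤ 1 / 2 := fun y => by
        rw [val_mul]
        grind
      rw [hsq, hsq] at i3
      rw [pow_succ]
      by_cases hx : (f x).1 ≤ 1 / 2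
      · rw [double _ hx, double _ (i3.1 hx), ← mul_sub, abs_mul, abs_two] at i2
        linarith
      · have hx' := mt i3.2 hx
        rw [val_mul, val_mul, max_eq_right (by linarith), max_eq_right (by linarith)] at i1
        have : (f x).1 + (f x).1 - 1 - ((g x).1 + (g x).1 - 1) = 2 * ((f x).1 - (g x).1) := by ring
        rw [this, abs_mul, abs_two] at i1
        linarith
  funext x
  refine ext (sub_eq_zero.1 (abs_eq_zero.1 (_root_.le_antisymm ?_ (abs_nonneg _))))
  exact ge_of_tendsto' (tendsto_pow_atTop_nhds_zero_of_lt_one (by norm_num) (by norm_num))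
    fun n => key n x

/-- A homomorphism to the unit interval is determined by a lower bound of its kernel. -/
theorem hom_ext_of_le {f g : B → R01} (hf : IsHom f) (hg : IsHom g)
    (h : ∀ x, f x = 1 → g x = 1) : f = g := by
  refine hom_ext hf hg fun x => ⟨h x, fun hx => ?_⟩
  by_contra hne
  obtain ⟨n, hn⟩ := nil.2 _ hne
  have h1 : g (x ^ n ⇨ 0) = 1 := h _ (by rw [hf.map_neg, hf.map_pow, hn, Hoop.imp_self])
  rw [hg.map_neg, hg.map_pow, hx, one_pow, one_imp] at h1
  exact nil.1 h1

end R01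
end BH

namespace BH

open Filter Topology

/-! ### Nilpotent bounded hoops embed into the unit interval -/

namespace Hoop.Nil

variable {A : Type u} [BoundedHoop A]

/-- The least exponent `k` with `e ^ k ≼ a`. -/
noncomputable def depth (e a : A) : ℕ := sInf {k : ℕ | e ^ k ≼ a}

theorem depth_le {e a : A} {k : ℕ} (h : e ^ k ≼ a) : depth e a ≤ k := Nat.sInf_le h

theorem imp_pow_sub {e a b : A} {k l : ℕ} (ha : a ≼ e ^ l) (hb : e ^ k ≼ b) :
    e ^ (k - l) ≼ a ⇨ b := by
  rw [le_imp_iff]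
  refine le_trans (mul_le_mul (le_refl _) ha) (le_trans ?_ hb)
  rw [← pow_add]
  exact pow_le_pow_right e (by omega)

variable (hA : Nil A) {e : A} (he : e ≠ 1)
include hA he

theorem pow_depth_le (a : A) : e ^ depth e a ≼ a := by
  obtain ⟨n, hn⟩ := hA.2 e he
  exact Nat.sInf_mem (s := {k : ℕ | e ^ k ≼ a}) ⟨n, by
    rw [Set.mem_ofPred_eq, hn]
    exact zero_le a⟩

omit he in
theorem le_pow_of_lt {a : A} {l : ℕ} (h : l < depth e a) : a ≼ e ^ l :=
  (hA.total (e ^ l) a).resolve_left fun hle => absurd (depth_le hle) (not_le.2 h)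

theorem depth_mono {a b : A} (h : a ≼ b) : depth e b ≤ depth e a :=
  depth_le (le_trans (hA.pow_depth_le he a) h)

theorem depth_le_depth_zero (a : A) : depth e a ≤ depth e 0 := hA.depth_mono he (zero_le a)

theorem lt_depth_zero {n : ℕ} (h : e ^ n ≠ 0) : n < depth e 0 := by
  by_contra hle
  refine h (eq_zero_of_le (le_trans (pow_le_pow_right e (not_lt.1 hle)) ?_))
  exact hA.pow_depth_le he 0

theorem depth_zero_pos : 0 < depth e 0 :=
  hA.lt_depth_zero he (by rw [pow_zero]; exact hA.1.symm)

theorem depth_le_add {a b : A} (h : b ≼ a) : depth e b ≤ depth e a + depth e (a ⇨ b) := by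
  refine depth_le ?_
  rw [pow_add, mul_comm, ← imp_mul_of_le h]
  exact mul_le_mul (by rw [imp_mul_of_le h]; exact hA.pow_depth_le he _) (hA.pow_depth_le he _)

/-- Totality gives `a ≼ e ^ l` only for `l` below the depth of `a`; this rounding costs the `1`. -/
theorem add_depth_le {a b : A} (h : b ≼ a) : depth e a + depth e (a ⇨ b) ≤ depth e b + 1 := by
  have hab := hA.depth_mono he h
  rcases Nat.eq_zero_or_pos (depth e a) with h0 | h0
  · have := hA.pow_depth_le he a
    rw [h0, pow_zero] at this
    rw [eq_one_of_one_le this, one_imp, ← eq_one_of_one_le this, h0]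
    omega
  · have := depth_le (imp_pow_sub (hA.le_pow_of_lt (Nat.sub_lt h0 one_pos))
      (hA.pow_depth_le he b))
    omega

/-- With `l + 1` the depth of `a`, the element `e ^ l ⇨ a` is not `1`, so it is below the coatom
`e`. Thus `a ≼ e ^ (l + 1)` and the rounding error disappears. -/
theorem add_depth_le_of_coatom (hmax : ∀ x : A, x ≠ 1 → x ≼ e) {a b : A} (h : b ≼ a) :
    depth e a + depth e (a ⇨ b) ≤ depth e b := by
  have hab := hA.depth_mono he h
  have ha : a ≼ e ^ depth e a := by
    rcases Nat.eq_zero_or_pos (depth e a) with h0 | h0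
    · rw [h0, pow_zero]; exact le_one a
    · obtain ⟨l, hl⟩ := Nat.exists_eq_succ_of_ne_zero h0.ne'
      have hle : a ≼ e ^ l := hA.le_pow_of_lt (by omega)
      rw [hl, pow_succ, mul_comm, ← imp_mul_of_le hle]
      have hne : e ^ l ⇨ a ≠ 1 := fun h => by
        have := depth_le h
        omega
      rw [imp_mul_of_le hle]
      conv_lhs => rw [← imp_mul_of_le hle]
      exact mul_le_mul_right (hmax _ hne) _
  have := depth_le (imp_pow_sub ha (hA.pow_depth_le he b))
  omega

omit he in
theorem exists_pow_ne_zero (hmax : ∀ e : A, e ≠ 1 → ∃ x : A, x ≠ 1 ∧ ¬ x ≼ e) (n : ℕ) :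
    ∃ e : A, e ≠ 1 ∧ e ^ (n + 1) ≠ 0 := by
  induction n with
  | zero =>
    obtain ⟨x, hx, hx0⟩ := hmax 0 hA.1
    exact ⟨x, hx, fun h => hx0 (by rw [← h, zero_add, pow_one]; exact le_refl x)⟩
  | succ n ih =>
    obtain ⟨e, he, hen⟩ := ih
    obtain ⟨x, hx, hxe⟩ := hmax e he
    have hex : e ≼ x := (hA.total x e).resolve_left hxe
    -- Since `e = (x ⇨ e) * x`, the larger factor serves as an approximate square root of `e`.
    obtain ⟨d, hd, hed⟩ : ∃ d : A, d ≠ 1 ∧ e ≼ d ^ 2 := by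
      rcases hA.total x (x ⇨ e) with hle | hle
      · refine ⟨x ⇨ e, hxe, ?_⟩
        rw [pow_two]
        conv_lhs => rw [← imp_mul_of_le hex]
        exact mul_le_mul (le_refl _) hle
      · refine ⟨x, hx, ?_⟩
        rw [pow_two]
        conv_lhs => rw [← imp_mul_of_le hex]
        exact mul_le_mul hle (le_refl _)
    refine ⟨d, hd, fun h => hen (eq_zero_of_le ?_)⟩
    refine le_trans (pow_le_pow_left hed (n + 1)) ?_
    rw [← pow_mul, ← h]
    exact pow_le_pow_right d (by omega)

omit he in
/-- There are scales with relatively small error of the depth function. -/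
theorem exists_scale (n : ℕ) : ∃ e : A, e ≠ 1 ∧ ∀ a b : A, b ≼ a →
    n * (depth e a + depth e (a ⇨ b)) ≤ n * depth e b + depth e 0 := by
  -- At a coatom the depth is exactly additive. Without one, `e` can be taken so close to `1` that
  -- the error `1`, multiplied by `n`, is less than the depth of `0`.
  by_cases hmax : ∃ e : A, e ≠ 1 ∧ ∀ x : A, x ≠ 1 → x ≼ e
  · obtain ⟨e, he, hmax⟩ := hmax
    exact ⟨e, he, fun a b h => (Nat.mul_le_mul_left n
      (hA.add_depth_le_of_coatom he hmax h)).trans (Nat.le_add_right _ _)⟩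
  · push Not at hmax
    obtain ⟨e, he, hen⟩ := hA.exists_pow_ne_zero hmax n
    refine ⟨e, he, fun a b h => ?_⟩
    have h1 := Nat.mul_le_mul_left n (hA.add_depth_le he h)
    have h2 := hA.lt_depth_zero he hen
    rw [Nat.mul_add n _ 1, Nat.mul_one] at h1
    omega

omit he in
/-- The measure of the distance to `1`. -/
theorem exists_measure : ∃ μ : A → ℝ, μ 0 = 1 ∧ (∀ a, 0 ≤ μ a) ∧
    ∀ a b, b ≼ a → μ a + μ (a ⇨ b) = μ b := by
  choose e he herr using hA.exists_scale
  set r : A → ℕ → ℝ := fun a n => depth (e n) a / depth (e n) 0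
  have hpos : ∀ n, (0 : ℝ) < depth (e n) 0 := fun n => by
    exact_mod_cast hA.depth_zero_pos (he n)
  have hr : ∀ a n, r a n ∈ Set.Icc (0 : ℝ) 1 := fun a n =>
    ⟨by positivity, (div_le_one (hpos n)).2 (by exact_mod_cast hA.depth_le_depth_zero (he n) a)⟩
  -- A nonprincipal ultrafilter gives every `a` a limit at once, and the relative error `1 / n`
  -- tends to `0` along it.
  have hlim : ∀ a, ∃ x, Tendsto (r a) (hyperfilter ℕ : Filter ℕ) (𝓝 x) := fun a => by
    obtain ⟨x, -, hx⟩ := isCompact_Icc.ultrafilter_le_nhds ((hyperfilter ℕ).map (r a))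
      (le_principal_iff.2 (Filter.mem_map.2 (Filter.univ_mem' (hr a))))
    exact ⟨x, hx⟩
  choose μ hμ using hlim
  have hinv : Tendsto (fun n : ℕ => 1 / (n : ℝ)) (hyperfilter ℕ : Filter ℕ) (𝓝 0) :=
    tendsto_one_div_atTop_nhds_zero_nat.mono_left
      (Nat.cofinite_eq_atTop ▸ hyperfilter_le_cofinite)
  refine ⟨μ, ?_, fun a => ge_of_tendsto' (hμ a) fun n => (hr a n).1, fun a b h => ?_⟩
  · refine tendsto_nhds_unique (hμ 0) (tendsto_const_nhds.congr fun n => ?_)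
    exact (div_self (hpos n).ne').symm
  · refine _root_.le_antisymm ?_ (le_of_tendsto_of_tendsto' (hμ b) ((hμ a).add (hμ (a ⇨ b)))
      fun n => ?_)
    · have := (hμ b).add hinv
      rw [add_zero] at this
      refine le_of_tendsto_of_tendsto ((hμ a).add (hμ (a ⇨ b))) this ?_
      have hne : ∀ᶠ n in (hyperfilter ℕ : Filter ℕ), 0 < n :=
        (Nat.cofinite_eq_atTop ▸ hyperfilter_le_cofinite : (hyperfilter ℕ : Filter ℕ) ≤ atTop)
          (eventually_gt_atTop 0)
      filter_upwards [hne] with n hn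
      have h1 : (n * (depth (e n) a + depth (e n) (a ⇨ b)) : ℝ) ≤
          n * depth (e n) b + depth (e n) 0 := by exact_mod_cast herr n a b h
      have hn' : (0 : ℝ) < n := by exact_mod_cast hn
      have := hpos n
      change (_ / _ + _ / _ : ℝ) ≤ _ / _ + _
      rw [← add_div, div_add_div _ _ this.ne' hn'.ne', div_le_div_iff₀ this (by positivity)]
      nlinarith
    · change (_ / _ : ℝ) ≤ _ / _ + _ / _
      rw [← add_div]
      gcongr
      exact_mod_cast hA.depth_le_add (he n) h

omit he in
/-- A nilpotent bounded hoop has a homomorphism to the unit interval. -/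
theorem exists_hom : ∃ f : A → R01, IsHom f := by
  obtain ⟨μ, h0, hnn, hadd⟩ := hA.exists_measure
  have h1 : μ 1 = 0 := by
    have := hadd 1 1 (le_refl 1)
    rw [imp_self] at this
    linarith
  have hmono : ∀ {a b : A}, b ≼ a → μ a ≤ μ b := fun {a b} h => by
    linarith [hadd a b h, hnn (a ⇨ b)]
  have hle : ∀ a, μ a ≤ 1 := fun a => h0 ▸ hmono (zero_le a)
  refine ⟨fun a => ⟨1 - μ a, sub_nonneg.2 (hle a), by linarith [hnn a]⟩,
    ⟨⟨R01.ext ?_, fun a b => R01.ext ?_, fun a b => R01.ext ?_⟩, R01.ext ?_⟩⟩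
  · change 1 - μ 1 = 1
    rw [h1, sub_zero]
  · change 1 - μ (a * b) = max 0 (1 - μ a + (1 - μ b) - 1)
    by_cases hab : a * b = 0
    · have h2 := hadd a 0 (zero_le a)
      have h3 : μ (a ⇨ 0) ≤ μ b := hmono (le_imp_iff.2 (by rw [mul_comm, hab]; exact le_refl 0))
      rw [hab, h0, max_eq_left] <;> linarith
    -- For a nonzero product, cancellation gives `a ⇨ (a * b) = b`, so `μ` is additive on it.
    · have h2 := hadd a (a * b) (mul_le_left a b)
      have h3 : a * b = a * (a ⇨ (a * b)) := by
        rw [mul_comm a (_ ⇨ _), imp_mul_of_le (mul_le_left a b)]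
      rw [← hA.mul_cancel h3 hab] at h2
      rw [max_eq_right] <;> linarith [hle (a * b)]
  · change 1 - μ (a ⇨ b) = min 1 (1 - (1 - μ a) + (1 - μ b))
    rcases hA.total a b with h | h
    · have := hmono h
      rw [h, h1, min_eq_left] <;> linarith
    · have := hadd a b h
      have := hmono h
      rw [min_eq_right] <;> linarith
  · change 1 - μ 0 = 0
    rw [h0, sub_self]

end Hoop.Nil

namespace Hoop

variable {A : Type u} [BoundedHoop A]

/-- A proper filter is contained in the kernel of a homomorphism to the unit interval. -/
theorem exists_hom_of_filter {F : Set A} (hF : IsFilter F) (h0 : (0 : A) ∉ F) :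
    ∃ f : A → R01, IsHom f ∧ ∀ x ∈ F, f x = 1 := by
  obtain ⟨M, hM, hFM, hnil⟩ := exists_filter_nil hF h0
  obtain ⟨f, hf⟩ := hnil.exists_hom
  refine ⟨f ∘ hM.proj, hf.comp hM.isHom_proj, fun x hx => ?_⟩
  rw [Function.comp, hM.proj_eq_one.2 (hFM hx), hf.map_one]

end Hoop

end BH

namespace BH

open Hoop

/-! ### Injectivity of powers of the unit interval -/

/-- The image of the kernel of `g` generates a proper filter because `f` is injective. If `h` kills
it, the kernel of `h ∘ f` contains that of `g`, which forces equality. -/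
theorem R01.exists_extension {B : Type u} {C : Type v} [BoundedHoop B] [BoundedHoop C]
    {f : B → C} {g : B → R01} (hf : IsHom f) (hinj : Function.Injective f) (hg : IsHom g) :
    ∃ h : C → R01, IsHom h ∧ h ∘ f = g := by
  have hF : IsFilter {c | ∃ b, g b = 1 ∧ f b ≼ c} :=
    { one_mem := ⟨1, hg.map_one, le_one _⟩
      mul_mem := by
        rintro x y ⟨a, ha, hax⟩ ⟨b, hb, hby⟩
        exact ⟨a * b, by rw [hg.map_mul, ha, hb, mul_one],
          by rw [hf.map_mul]; exact Hoop.mul_le_mul hax hby⟩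
      mem_of_le := by
        rintro x y ⟨a, ha, hax⟩ h
        exact ⟨a, ha, Hoop.le_trans hax h⟩ }
  obtain ⟨h, hh, hK⟩ := exists_hom_of_filter hF (by
    rintro ⟨b, hb, hle⟩
    have := eq_zero_of_le hle
    rw [← hf.map_zero] at this
    rw [hinj this, hg.map_zero] at hb
    exact R01.nil.1 hb)
  exact ⟨h, hh, (R01.hom_ext_of_le hg (hh.comp hf) fun b hb => hK _ ⟨b, hb, Hoop.le_refl _⟩).symm⟩

theorem IsHom.eval {I : Type u} (S : I → Type v) [∀ i, BoundedHoop (S i)] (i : I) :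
    IsHom fun x : ∀ i, S i => x i where
  map_one := rfl
  map_mul _ _ := rfl
  map_imp _ _ := rfl
  map_zero := rfl

theorem IsHom.pi {I : Type u} {S : I → Type v} [∀ i, BoundedHoop (S i)] {B : Type w}
    [BoundedHoop B] {f : ∀ i, B → S i} (hf : ∀ i, IsHom (f i)) :
    IsHom fun (b : B) i => f i b where
  map_one := funext fun i => (hf i).map_one
  map_mul x y := funext fun i => (hf i).map_mul x y
  map_imp x y := funext fun i => (hf i).map_imp x y
  map_zero := funext fun i => (hf i).map_zero

theorem isInjective_pow (I : Type u) : IsInjective (I → R01) := by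
  intro B C _ _ f g hf hinj hg
  choose h hh hhf using fun i => R01.exists_extension hf hinj ((IsHom.eval (fun _ => R01) i).comp hg)
  exact ⟨fun c i => h i c, IsHom.pi hh, funext fun b => funext fun i => congrFun (hhf i) b⟩

theorem IsRetract.isInjective {A B : Type u} [BoundedHoop A] [BoundedHoop B]
    (h : IsRetract B A) (hA : IsInjective A) : IsInjective B := by
  obtain ⟨i, r, hi, hr, hri⟩ := h
  intro C D _ _ f g hf hinj hg
  obtain ⟨k, hk, hkf⟩ := hA C D f (i ∘ g) hf hinj (hi.comp hg)
  refine ⟨r ∘ k, hr.comp hk, ?_⟩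
  rw [Function.comp_assoc, hkf, ← Function.comp_assoc, hri, Function.id_comp]

/-! ### Adjoining a bottom element -/

/-- A hoop with a new bottom element adjoined: the ordinal sum of the two-element hoop and `H`. -/
inductive Lift (H : Type u) : Type u
  | bot : Lift H
  | of (x : H) : Lift H

namespace Lift

variable {H : Type u}

/-- The product of `Lift H`. -/
def mul [Mul H] : Lift H → Lift H → Lift H
  | of x, of y => of (x * y)
  | _, _ => bot

/-- The residuum of `Lift H`. -/
def imp [HImp H] [One H] : Lift H → Lift H → Lift H
  | bot, _ => of 1
  | of _, bot => bot
  | of x, of y => of (x ⇨ y)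

instance [Hoop H] : BoundedHoop (Lift H) where
  mul := mul
  one := of 1
  himp := imp
  zero := bot
  mul_assoc := by
    rintro (_ | x) (_ | y) (_ | z) <;> first | rfl | exact congrArg of (mul_assoc x y z)
  one_mul := by
    rintro (_ | x)
    exacts [rfl, congrArg of (one_mul x)]
  mul_one := by
    rintro (_ | x)
    exacts [rfl, congrArg of (mul_one x)]
  mul_comm := by
    rintro (_ | x) (_ | y) <;> first | rfl | exact congrArg of (mul_comm x y)
  imp_self := by
    rintro (_ | x)
    exacts [rfl, congrArg of (Hoop.imp_self x)]
  imp_mul_comm := by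
    rintro (_ | x) (_ | y) <;> first | rfl | exact congrArg of (Hoop.imp_mul_comm x y)
  imp_imp := by
    rintro (_ | x) (_ | y) (_ | z) <;> first
      | rfl | exact congrArg of (Hoop.imp_imp x y z) | exact congrArg of (Hoop.le_one x)
  zero_imp := by
    rintro (_ | x) <;> rfl

end Lift

/-- The dense elements of a bounded hoop. -/
def Dense (A : Type u) [BoundedHoop A] : Type u := {x : A // x ⇨ 0 = 0}

instance (A : Type u) [BoundedHoop A] : Hoop (Dense A) where
  mul x y := ⟨x.1 * y.1, dense_mul x.2 y.2⟩
  one := ⟨1, Hoop.one_imp 0⟩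
  himp x y := ⟨x.1 ⇨ y.1, dense_of_le y.2 (le_imp _ _)⟩
  mul_assoc x y z := Subtype.ext (mul_assoc x.1 y.1 z.1)
  one_mul x := Subtype.ext (one_mul x.1)
  mul_one x := Subtype.ext (mul_one x.1)
  mul_comm x y := Subtype.ext (mul_comm x.1 y.1)
  imp_self x := Subtype.ext (Hoop.imp_self x.1)
  imp_mul_comm x y := Subtype.ext (Hoop.imp_mul_comm x.1 y.1)
  imp_imp x y z := Subtype.ext (Hoop.imp_imp x.1 y.1 z.1)

/-! ### Injective bounded hoops -/

namespace IsInjective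

variable {A : Type u} [BoundedHoop A] (hA : IsInjective A)
include hA

/-- The embedding `f` leaves room for a new element strictly between `0` and all dense elements. An
extension of `g` sends it to some `t`, dense and below every dense element. -/
theorem eq_one_of_dense {x : A} (hx : x ⇨ 0 = 0) : x = 1 := by
  let f : Lift (Dense A) → Lift (Lift (Dense A))
    | .bot => .bot
    | .of d => .of (.of d)
  let g : Lift (Dense A) → A
    | .bot => 0
    | .of d => d.1
  have hf : IsHom f := by
    refine ⟨⟨rfl, ?_, ?_⟩, rfl⟩ <;> rintro (_ | y) (_ | z) <;> rfl
  have hg : IsHom g := by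
    refine ⟨⟨rfl, ?_, ?_⟩, rfl⟩
    · rintro (_ | y) (_ | z)
      exacts [(Hoop.zero_mul 0).symm, (Hoop.zero_mul _).symm, (Hoop.mul_zero _).symm, rfl]
    · rintro (_ | y) (_ | z)
      exacts [(Hoop.zero_le _).symm, (Hoop.zero_le _).symm, y.2.symm, rfl]
  have hinj : Function.Injective f := by
    rintro (_ | y) (_ | z) h
    · rfl
    · nomatch h
    · nomatch h
    · injection h with h
  obtain ⟨h, hh, hhf⟩ := hA _ _ f g hf hinj hg
  have hd : ∀ d : Dense A, h (.of (.of d)) = d.1 := fun d => congrFun hhf (.of d)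
  set t := h (.of .bot) with ht
  have h0 : t ⇨ 0 = 0 := by
    rw [ht, ← hh.map_neg, ← hh.map_zero]
    rfl
  -- Every dense `d` satisfies `d ⇨ t = t`, and `t` is itself dense.
  have h1 : t ⇨ t = t := by
    have : (Lift.of (Lift.of (show Dense A from ⟨t, h0⟩)) ⇨ Lift.of Lift.bot) = Lift.of Lift.bot := rfl
    have := congrArg h this
    rw [hh.map_imp, hd] at this
    exact this
  have h2 : t ≼ x := by
    have : Lift.of Lift.bot ≼ Lift.of (Lift.of (show Dense A from ⟨x, hx⟩)) := rfl
    have := hh.map_le this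
    rw [hd] at this
    exact this
  rw [Hoop.imp_self] at h1
  rw [← h1] at h2
  exact eq_one_of_one_le h2

theorem involutive : Involutive A := involutive_of_dense fun _ => hA.eq_one_of_dense

end IsInjective

/-! ### The radical of an involutive bounded hoop -/

namespace Hoop

variable (A : Type u) [BoundedHoop A]

/-- The radical: the elements that every homomorphism to the unit interval maps to `1`. -/
def radical : Set A := {x | ∀ f : A → R01, IsHom f → f x = 1}

theorem isFilter_radical : IsFilter (radical A) where
  one_mem _ hf := hf.map_one
  mul_mem hx hy f hf := by rw [hf.map_mul, hx f hf, hy f hf, mul_one]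
  mem_of_le hx h f hf := by
    have := hf.map_le h
    rw [hx f hf] at this
    exact eq_one_of_one_le this

variable {A}

theorem exists_neg_pow_eq_zero {x : A} (hx : x ∈ radical A) : ∃ n : ℕ, (x ⇨ 0) ^ n = 0 := by
  by_contra hne
  obtain ⟨f, hf, h⟩ := exists_hom_of_filter
    (isFilter_adjoin isFilter_singleton_one (x ⇨ 0)) fun ⟨n, hn⟩ => hne ⟨n, eq_zero_of_le hn⟩
  have := h (x ⇨ 0) ⟨1, by rw [pow_one]; exact Hoop.le_refl _⟩
  rw [hf.map_neg, hx f hf, Hoop.one_imp] at this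
  exact R01.nil.1 this

/-- Prelinearity for `x` and `x ⇨ 0` shows that implication from `(x * x) ⇨ 0` fixes `(x ⇨ 0) ⇨ x`.
That antecedent is nilpotent, since `x * x` is in the radical. -/
theorem Involutive.neg_le_of_mem_radical (hA : Involutive A) {x : A} (hx : x ∈ radical A) :
    x ⇨ 0 ≼ x := by
  have h1 : ((x * x) ⇨ 0) ⇨ ((x ⇨ 0) ⇨ x) = (x ⇨ 0) ⇨ x := by
    have := hA.imp_imp_imp_swap x (x ⇨ 0)
    rwa [Hoop.imp_imp x x 0] at this
  obtain ⟨n, hn⟩ := exists_neg_pow_eq_zero ((isFilter_radical A).mul_mem hx hx)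
  have h2 := pow_imp_eq h1 n
  rwa [hn, zero_le, eq_comm] at h2

theorem Involutive.neg_sq_of_mem_radical (hA : Involutive A) {x : A} (hx : x ∈ radical A) :
    (x ⇨ 0) * (x ⇨ 0) = 0 := by
  have h := mul_le_mul_right (hA.neg_le_of_mem_radical hx) (x ⇨ 0)
  rw [mul_comm x, imp_zero_mul] at h
  exact eq_zero_of_le h

theorem Involutive.eq_one_of_mem_radical (hA : Involutive A) {x : A} (hx : x ∈ radical A)
    (h : x * x = x) : x = 1 := by
  have h1 : x ⇨ 0 = 0 := by
    have h2 := hA.neg_le_of_mem_radical hx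
    rw [← imp_mul_of_le h2, Hoop.imp_imp, h, imp_zero_mul]
  rw [← hA x, h1, Hoop.imp_self]

/-- If `f x ≠ 1`, some `f (x ^ n)` is `0`, and `f` would send the square to `1`. The criterion is
equational, so it can be checked coordinatewise in a power of `A`. -/
theorem mem_radical_of_neg_sq {x : A} (h : ∀ n : ℕ, (x ^ n ⇨ 0) * (x ^ n ⇨ 0) = 0) :
    x ∈ radical A := fun f hf => by
  by_contra hne
  obtain ⟨n, hn⟩ := R01.nil.2 _ hne
  have := congrArg f (h n)
  rw [hf.map_mul, hf.map_neg, hf.map_pow, hn, Hoop.imp_self, mul_one, hf.map_zero] at this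
  exact R01.nil.1 this.symm

theorem radical_map {B : Type v} [BoundedHoop B] {f : A → B} (hf : IsHom f) {x : A}
    (hx : x ∈ radical A) : f x ∈ radical B := fun g hg => hx (g ∘ f) (hg.comp hf)

/-- The filter of functions on the radical which are eventually `1` in the decreasing
direction. -/
theorem isFilter_eventually_one :
    IsFilter {f : radical A → A | ∃ d : radical A, ∀ s : radical A, s.1 ≼ d.1 → f s = 1} where
  one_mem := ⟨⟨1, (isFilter_radical A).one_mem⟩, fun _ _ => rfl⟩
  mul_mem := by
    rintro f g ⟨d, hd⟩ ⟨e, he⟩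
    refine ⟨⟨d.1 * e.1, (isFilter_radical A).mul_mem d.2 e.2⟩, fun s hs => ?_⟩
    change f s * g s = 1
    rw [hd s (Hoop.le_trans hs (mul_le_left _ _)), he s (Hoop.le_trans hs (mul_le_right _ _)),
      mul_one]
  mem_of_le := by
    rintro f g ⟨d, hd⟩ h
    refine ⟨d, fun s hs => ?_⟩
    have : f s ⇨ g s = 1 := congrFun h s
    rw [hd s hs] at this
    exact eq_one_of_one_le this

end Hoop

/-! ### Separation of points and the retraction from a power -/

namespace IsInjective

variable {A : Type u} [BoundedHoop A] (hA : IsInjective A)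
include hA

/-- In the reduced power of `A` over its radical, directed downwards, the inclusion `b` is a radical
element below every constant from the radical. A retraction `h` onto `A` sends it to a least element
of the radical, which is idempotent and hence `1`. -/
theorem eq_one_of_mem_radical {x : A} (hx : x ∈ radical A) : x = 1 := by
  have hF := isFilter_eventually_one (A := A)
  have hconst : IsHom (hF.proj ∘ fun (a : A) (_ : radical A) => a) :=
    hF.isHom_proj.comp ⟨⟨rfl, fun _ _ => rfl, fun _ _ => rfl⟩, rfl⟩
  have hinj : Function.Injective (hF.proj ∘ fun (a : A) (_ : radical A) => a) := by
    refine hconst.injective_of_kernel fun a ha => ?_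
    obtain ⟨d, hd⟩ := hF.proj_eq_one.1 ha
    exact hd d (Hoop.le_refl _)
  obtain ⟨h, hh, hhf⟩ := hA _ _ _ id hconst hinj ⟨⟨rfl, fun _ _ => rfl, fun _ _ => rfl⟩, rfl⟩
  have hc : ∀ a : A, h (hF.proj fun _ => a) = a := fun a => congrFun hhf a
  set b : radical A → A := fun s => s.1
  have hb : ∀ n : ℕ, b ^ n = fun s => s.1 ^ n := fun n => by
    induction n with
    | zero => simp only [pow_zero]; rfl
    | succ n ih => simp only [pow_succ, ih]; rfl
  have hle : ∀ d ∈ radical A, h (hF.proj b) ≼ d := fun d hd => by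
    have : hF.proj b ≼ hF.proj fun _ => d := by
      rw [Le, ← hF.isHom_proj.map_imp]
      exact hF.proj_eq_one.2 ⟨⟨d, hd⟩, fun s hs => hs⟩
    have := hh.map_le this
    rwa [hc] at this
  have hrad : h (hF.proj b) ∈ radical A := by
    refine radical_map (hh.comp hF.isHom_proj) (mem_radical_of_neg_sq fun n => ?_)
    rw [hb]
    exact funext fun s =>
      hA.involutive.neg_sq_of_mem_radical ((isFilter_radical A).pow_mem s.2 n)
  have hidem := Hoop.le_antisymm (mul_le_left (h (hF.proj b)) _)
    (hle _ ((isFilter_radical A).mul_mem hrad hrad))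
  have h1 := hA.involutive.eq_one_of_mem_radical hrad hidem
  have := hle x hx
  rw [h1] at this
  exact eq_one_of_one_le this

/-- The homomorphisms to the unit interval separate points. -/
theorem injective_eval : Function.Injective fun (a : A) (f : {f : A → R01 // IsHom f}) => f.1 a :=
  IsHom.injective_of_kernel (IsHom.pi fun f : {f : A → R01 // IsHom f} => f.2) fun _ hx =>
    hA.eq_one_of_mem_radical fun f hf => congrFun hx ⟨f, hf⟩

theorem exists_isRetract : ∃ I : Type u, IsRetract A (I → R01) := by
  have hom := IsHom.pi fun f : {f : A → R01 // IsHom f} => f.2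
  obtain ⟨r, hr, hri⟩ := hA _ _ _ id hom hA.injective_eval
    ⟨⟨rfl, fun _ _ => rfl, fun _ _ => rfl⟩, rfl⟩
  exact ⟨_, _, r, hom, hr, hri⟩

/-- The factors are quotients by kernels of homomorphisms to `R01`; they inherit nilpotency from
`R01`, and the projections are onto. -/
theorem isSemisimple : IsSemisimple A := by
  have hK : ∀ f : {f : A → R01 // IsHom f}, IsFilter {x | f.1 x = 1} := fun f =>
    { one_mem := f.2.map_one
      mul_mem := fun {x y} hx hy => by
        have hx : f.1 x = 1 := hx
        have hy : f.1 y = 1 := hy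
        rw [Set.mem_ofPred_eq, f.2.map_mul, hx, hy, mul_one]
      mem_of_le := fun {x y} hx h => by
        have := f.2.map_le h
        rw [show f.1 x = 1 from hx] at this
        exact eq_one_of_one_le this }
  have hom := IsHom.pi fun f => (hK f).isHom_proj
  refine ⟨{f : A → R01 // IsHom f}, fun f => (hK f).Quo, inferInstance, _, fun f => ?_, hom,
    hom.injective_of_kernel fun x hx => ?_, fun f => (hK f).proj_surjective⟩
  · refine nil_iff_isSimple.1 ((hK f).nil_quo (fun h => R01.nil.1 ?_) fun x hx => ?_)
    · rw [← f.2.map_zero]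
      exact h
    · obtain ⟨n, hn⟩ := R01.nil.2 _ hx
      refine ⟨n, ?_⟩
      rw [Set.mem_ofPred_eq, f.2.map_neg, f.2.map_pow, hn, Hoop.imp_self]
  · exact hA.eq_one_of_mem_radical fun f hf => (hK ⟨f, hf⟩).proj_eq_one.1 (congrFun hx ⟨f, hf⟩)

end IsInjective

/-! ### Simple bounded hoops -/

namespace Hoop.Involutive

variable {A : Type u} [BoundedHoop A]

/-- The lattice structure of an involutive bounded hoop. -/
abbrev lattice (hA : Involutive A) : Lattice A where
  le := Le
  le_refl := Hoop.le_refl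
  le_trans _ _ _ := Hoop.le_trans
  le_antisymm _ _ := Hoop.le_antisymm
  sup x y := (x ⇨ y) ⇨ y
  inf x y := (x ⇨ y) * x
  le_sup_left := le_imp_imp
  le_sup_right x y := le_imp y _
  sup_le _ _ _ := hA.imp_imp_le
  inf_le_left x y := mul_le_right _ x
  inf_le_right := imp_mul_le
  le_inf _ y _ hy hz := by
    rw [← imp_mul_of_le hy]
    exact mul_le_mul_right (imp_le_imp (Hoop.le_refl y) hz) y

theorem isMVAlgebra (hA : Involutive A) :
    let _ := hA.lattice
    IsMVAlgebra A :=
  let _ := hA.lattice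
  { zero_le := zero_le
    le_one := Hoop.le_one
    mul_imp := fun x y z => (Hoop.imp_imp x y z).symm
    imp_mul_inf := fun x y => inf_eq_left.2 (imp_mul_le x y)
    inf_imp := imp_mul_le
    -- The join unfolds to `((x ⇨ y) ⇨ (y ⇨ x)) ⇨ (y ⇨ x)`.
    prelinear := fun x y => (congrArg (· ⇨ (y ⇨ x)) (hA.imp_imp_imp_swap x y)).trans
      (Hoop.imp_self _)
    divisible := fun x _ => mul_comm x _
    involutive := hA }

end Hoop.Involutive

theorem IsSimple.isSimpleMV {A : Type u} [BoundedHoop A] [Lattice A] (hA : IsSimple A) :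
    IsSimpleMV A :=
  ⟨hA.1, fun r hr => hA.2 r
    ⟨fun x x' y y' h h' => (hr x x' y y' h h').1, fun x x' y y' h h' => (hr x x' y y' h h').2.1⟩⟩

/-- The element `f 0` is idempotent, and it is not `1` since otherwise `f` would be constant. In a
simple hoop it is then nilpotent, so it is `0`. -/
theorem IsHoopHom.map_zero_of_isSimple {A : Type u} {B : Type v} [BoundedHoop A] [BoundedHoop B]
    (hB : IsSimple B) {f : A → B} (hf : IsHoopHom f) (h : ∃ x, f x ≠ 1) : f 0 = 0 := by
  have h1 : f 0 ≠ 1 := fun h0 => by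
    obtain ⟨x, hx⟩ := h
    have := hf.map_imp 0 x
    rw [Hoop.zero_le, hf.map_one, h0, Hoop.one_imp] at this
    exact hx this.symm
  obtain ⟨n, hn⟩ := (nil_iff_isSimple.2 hB).2 _ h1
  have hidem : f 0 * f 0 = f 0 := by rw [← hf.map_mul, Hoop.zero_mul]
  rcases n with _ | n
  · rw [pow_zero] at hn
    exact eq_zero_of_le (hn ▸ Hoop.le_one (f 0))
  · have : IsIdempotentElem (f 0) := hidem
    rwa [this.pow_succ_eq] at hn

end BH

theorem corollary14p8 :
    (∀ (A : Type u) [BH.BoundedHoop A],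
      BH.IsInjective A ↔ ∃ I : Type u, BH.IsRetract A (I → BH.R01)) ∧
    (∀ (A : Type u) [BH.BoundedHoop A], BH.IsInjective A → BH.IsSemisimple A) ∧
    (∀ (A : Type u) [BH.BoundedHoop A], BH.IsSimple A →
      ∃ _ : Lattice A, BH.IsMVAlgebra A ∧ BH.IsSimpleMV A) ∧
    (∀ (A B : Type u) [BH.BoundedHoop A] [BH.BoundedHoop B], BH.IsSimple A → BH.IsSimple B →
      ∀ φ : A → B, BH.IsHoopHom φ → (∃ x, φ x ≠ 1) → φ 0 = 0) := by
  refine ⟨fun A _ => ⟨fun h => h.exists_isRetract, ?_⟩, fun A _ h => h.isSemisimple,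
    fun A _ h => ?_, fun A B _ _ _ hB φ hφ h => hφ.map_zero_of_isSimple hB h⟩
  · rintro ⟨I, h⟩
    exact h.isInjective (BH.isInjective_pow I)
  · have hinv := (BH.Hoop.nil_iff_isSimple.2 h).involutive
    exact ⟨hinv.lattice, hinv.isMVAlgebra, @BH.IsSimple.isSimpleMV A _ hinv.lattice h⟩
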